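/- All graphs are finite and simple. A graph is $k$-critical if it is not $(k-1)$-colorable but every proper subgraph of it is $(k-1)$-colorable. The Ore-degree $\Theta(G)$ of a graph $G$ is the maximum of $d(x)+d(y)$ over all edges $xy$ of $G$ (and $0$ if $G$ has no edges). Let $d\ge 5$. Then the only $(d+1)$-critical graph with maximum degree at most $d+1$ in which the vertices of degree $d+1$ form an independent set is $K_{d+1}$; that is, a graph $G$ is $(d+1)$-critical, satisfies $\Delta(G)\le d+1$, and has its vertices of degree $d+1$ forming an independent set if and only if $G\cong K_{d+1}$. Equivalently, every graph $G$ with $\chi(G)=d+1$ and $\Theta(G)\le 2d+1$ contains $K_{d+1}$ as a subgraph. -/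

import Mathlib

/-- `G` is `k`-critical (for a positive integer `k`): `G` is not `(k-1)`-colorable, but every proper
subgraph of `G` (obtained by deleting vertices and/or edges) is `(k-1)`-colorable. -/
def SimpleGraph.IsCritical {V : Type*} (G : SimpleGraph V) (k : ℕ) : Prop :=
  1 ≤ k ∧ ¬ G.Colorable (k - 1) ∧ ∀ H : G.Subgraph, H ≠ ⊤ → H.coe.Colorable (k - 1)

/-- The Ore-degree of a finite graph: the maximum of `d(x) + d(y)` over all edges `xy`
(and `0` if there are no edges). -/
def SimpleGraph.oreDegree {V : Type*} [Fintype V] (G : SimpleGraph V) [DecidableRel G.Adj] : ℕ :=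
  (Finset.univ.filter fun p : V × V => G.Adj p.1 p.2).sup fun p => G.degree p.1 + G.degree p.2

/-! Pass to a vertex-minimal induced subgraph that is not `d`-colorable; the Ore condition survives.
Call a vertex low if its degree is at most `d`, high otherwise: high vertices are independent. Write
`d = r + s`. Deleting a low `x` leaves parts `A`, `B`, colorable with `r` and `s` colors, in which
`x` has exactly `r` and `s` neighbours. If the weighted edge count of the parts is minimal, the
component of `x` in `A + x` is `r`-regular and any low vertex of it can be removed in place of `x`
(`MinSplit.regular`, `MinSplit.shift`).

Now move vertices alternately into the two sides. As long as no low triangle straddles the split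
(`Triple`), each component just left can be certified as closed to re-entry, so the vacated set
grows strictly (`Inv.step`). Finiteness therefore yields such a triangle (`Inv.exists_triple`).

All low neighbours of its vertex `x` are twins of `x` (`Triple.twin`). Hence the closed
neighbourhood of `x` has `d + 1` vertices, and its low vertices are adjacent to all the others in it
and to nothing outside. A recoloring argument, which needs the full strength of `5 ≤ d`, leaves at
most one high vertex there (`card_high_le_one`), so it is a clique. -/

namespace OreBrooks

/-! ### Partial colorings, connectivity and splits. -/

section Basic

open Finset
open scoped Classical

variable {V : Type*} {G : SimpleGraph V} {d r s : ℕ} {A B : Finset V} {x y z : V}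

/-- `G[A]` is `r`-colorable. -/
def ColOn (G : SimpleGraph V) (A : Finset V) (r : ℕ) : Prop :=
  ∃ c : V → Fin r, ∀ a ∈ A, ∀ b ∈ A, G.Adj a b → c a ≠ c b

/-- The neighbours of `x` in `A`. -/
noncomputable def nb (G : SimpleGraph V) (A : Finset V) (x : V) : Finset V := {a ∈ A | G.Adj x a}

/-- The degree of `x`. -/
noncomputable def dg [Fintype V] (G : SimpleGraph V) (x : V) : ℕ := #(nb G univ x)

/-- Twice the number of edges of `G[A]`. -/
noncomputable def edg (G : SimpleGraph V) (A : Finset V) : ℕ := ∑ a ∈ A, #(nb G A a)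

/-- `a` and `b` are joined by a walk in `G[A]` (or are equal). -/
def Conn (G : SimpleGraph V) (A : Finset V) : V → V → Prop :=
  Relation.ReflTransGen fun a b => a ∈ A ∧ b ∈ A ∧ G.Adj a b

theorem mem_nb {a : V} : a ∈ nb G A x ↔ a ∈ A ∧ G.Adj x a := by simp [nb]

theorem ColOn.mono {A' : Finset V} (h : ColOn G A r) (hA : A' ⊆ A) : ColOn G A' r := by
  obtain ⟨c, hc⟩ := h
  exact ⟨c, fun a ha b hb => hc a (hA ha) b (hA hb)⟩

theorem ColOn.union (hA : ColOn G A r) (hB : ColOn G B s) : ColOn G (A ∪ B) (r + s) := by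
  obtain ⟨c, hc⟩ := hA
  obtain ⟨e, he⟩ := hB
  refine ⟨fun v => if v ∈ A then Fin.castAdd s (c v) else Fin.natAdd r (e v), ?_⟩
  intro a ha b hb hab
  have hca := (c a).2
  have hcb := (c b).2
  by_cases h1 : a ∈ A <;> by_cases h2 : b ∈ A
  · simpa [h1, h2] using hc a h1 b h2 hab
  · simp only [h1, h2, if_true, if_false, ne_eq, Fin.ext_iff, Fin.val_castAdd, Fin.val_natAdd]
    omega
  · simp only [h1, h2, if_true, if_false, ne_eq, Fin.ext_iff, Fin.val_castAdd, Fin.val_natAdd]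
    omega
  · simpa [h1, h2] using
      he a ((mem_union.1 ha).resolve_left h1) b ((mem_union.1 hb).resolve_left h2) hab

theorem Conn.symm {a b : V} (h : Conn G A a b) : Conn G A b a := by
  induction h with
  | refl => exact .refl
  | tail _ h ih => exact Relation.ReflTransGen.head ⟨h.2.1, h.1, h.2.2.symm⟩ ih

theorem Conn.trans {a b c : V} (h : Conn G A a b) (h' : Conn G A b c) : Conn G A a c :=
  Relation.ReflTransGen.trans h h'

theorem Conn.mono {A' : Finset V} {a b : V} (hA : A ⊆ A') (h : Conn G A a b) : Conn G A' a b := by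
  induction h with
  | refl => exact .refl
  | tail _ h ih => exact ih.tail ⟨hA h.1, hA h.2.1, h.2.2⟩

theorem Conn.single {a b : V} (ha : a ∈ A) (hb : b ∈ A) (h : G.Adj a b) : Conn G A a b :=
  Relation.ReflTransGen.single ⟨ha, hb, h⟩

theorem Conn.mem {a b : V} (h : Conn G A a b) (ha : a ∈ A) : b ∈ A := by
  induction h with
  | refl => exact ha
  | tail _ h _ => exact h.2.1

/-- A walk starting in a set `F` that is closed under adjacency in `A` stays in `F`. -/
theorem Conn.closed {F : Finset V} (hF : ∀ a ∈ F, a ∈ A → ∀ b ∈ A, G.Adj a b → b ∈ F) {a b : V}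
    (h : Conn G A a b) (ha : a ∈ F) : b ∈ F ∧ Conn G (A ∩ F) a b := by
  induction h with
  | refl => exact ⟨ha, .refl⟩
  | tail _ h ih =>
    have := hF _ ih.1 h.1 _ h.2.1 h.2.2
    exact ⟨this, ih.2.tail ⟨mem_inter.2 ⟨h.1, ih.1⟩, mem_inter.2 ⟨h.2.1, this⟩, h.2.2⟩⟩

/-- A vertex reachable from `x` in `A + x` is `x` or is reachable in `A` from a neighbour of `x`. -/
theorem Conn.of_insert {u : V} (h : Conn G (insert x A) x u) :
    u = x ∨ ∃ a ∈ nb G A x, Conn G A a u := by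
  induction h with
  | refl => exact .inl rfl
  | @tail b c _ h ih =>
    by_cases hc : c = x
    · exact .inl hc
    right
    have hcA : c ∈ A := (mem_insert.1 h.2.1).resolve_left hc
    rcases ih with rfl | ⟨a, ha, hab⟩
    · exact ⟨c, mem_nb.2 ⟨hcA, h.2.2⟩, .refl⟩
    · exact ⟨a, ha, hab.trans (.single (hab.mem (mem_nb.1 ha).1) hcA h.2.2)⟩

theorem Conn.to_insert {a u : V} (ha : a ∈ nb G A x) (h : Conn G A a u) :
    Conn G (insert x A) x u :=
  .trans (.single (mem_insert_self _ _) (mem_insert_of_mem (mem_nb.1 ha).1) (mem_nb.1 ha).2)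
    (h.mono (subset_insert _ _))

theorem nb_insert_self (h : x ∉ A) : nb G (insert x A) x = nb G A x := by
  ext a
  simp only [mem_nb, mem_insert]
  constructor
  · rintro ⟨rfl | h1, h2⟩
    · exact (G.irrefl h2).elim
    · exact ⟨h1, h2⟩
  · exact fun h => ⟨.inr h.1, h.2⟩

theorem nb_erase_self : nb G (A.erase x) x = nb G A x := by
  ext a
  simp only [mem_nb, mem_erase]
  exact ⟨fun h => ⟨h.1.2, h.2⟩, fun h => ⟨⟨h.2.ne', h.1⟩, h.2⟩⟩

theorem card_nb_insert (h : x ∉ A) {a : V} :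
    #(nb G (insert x A) a) = #(nb G A a) + if G.Adj a x then 1 else 0 := by
  by_cases hax : G.Adj a x
  · have : nb G (insert x A) a = insert x (nb G A a) := by
      ext b; simp only [mem_nb, mem_insert]
      constructor
      · rintro ⟨rfl | h1, h2⟩ <;> tauto
      · rintro (rfl | h1) <;> tauto
    rw [this, card_insert_of_notMem (by simp [mem_nb, h]), if_pos hax]
  · have : nb G (insert x A) a = nb G A a := by
      ext b; simp only [mem_nb, mem_insert]
      constructor
      · rintro ⟨rfl | h1, h2⟩ <;> tauto
      · tauto
    rw [this, if_neg hax]; rfl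

theorem edg_insert (h : x ∉ A) : edg G (insert x A) = edg G A + 2 * #(nb G A x) := by
  unfold edg
  rw [sum_insert h, nb_insert_self h, sum_congr rfl fun a _ => card_nb_insert h, sum_add_distrib]
  have : ∑ a ∈ A, (if G.Adj a x then 1 else 0) = #(nb G A x) := by
    rw [nb, card_filter]
    exact sum_congr rfl fun a _ => by simp [G.adj_comm]
  omega

theorem edg_erase (h : x ∈ A) : edg G (A.erase x) + 2 * #(nb G A x) = edg G A := by
  have := edg_insert (G := G) (notMem_erase x A)
  rw [insert_erase h, nb_erase_self] at this
  exact this.symm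

/-- If `A + x` is not `r`-colorable, every `r`-coloring of `A` shows all colors around `x`. -/
theorem exists_nb_color (h : ¬ ColOn G (insert x A) r) (c : V → Fin r)
    (hc : ∀ a ∈ A, ∀ b ∈ A, G.Adj a b → c a ≠ c b) (k : Fin r) : ∃ a ∈ nb G A x, c a = k := by
  by_contra! hk
  apply h
  refine ⟨Function.update c x k, ?_⟩
  intro a ha b hb hab
  by_cases hax : a = x
  · subst hax
    have hba : b ≠ a := hab.ne'
    rw [Function.update_self, Function.update_of_ne hba]
    exact (hk b (mem_nb.2 ⟨(mem_insert.1 hb).resolve_left hba, hab⟩)).symm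
  by_cases hbx : b = x
  · subst hbx
    rw [Function.update_self, Function.update_of_ne hax]
    exact hk a (mem_nb.2 ⟨(mem_insert.1 ha).resolve_left hax, hab.symm⟩)
  rw [Function.update_of_ne hax, Function.update_of_ne hbx]
  exact hc a ((mem_insert.1 ha).resolve_left hax) b ((mem_insert.1 hb).resolve_left hbx) hab

theorem le_card_nb (h : ¬ ColOn G (insert x A) r) (hA : ColOn G A r) : r ≤ #(nb G A x) := by
  obtain ⟨c, hc⟩ := hA
  have : (univ : Finset (Fin r)) ⊆ (nb G A x).image c := fun k _ => by
    simpa using exists_nb_color h c hc k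
  simpa using (card_le_card this).trans card_image_le

theorem color_injOn (h : ¬ ColOn G (insert x A) r) (c : V → Fin r)
    (hc : ∀ a ∈ A, ∀ b ∈ A, G.Adj a b → c a ≠ c b) (hr : #(nb G A x) = r) :
    Set.InjOn c (nb G A x) := by
  apply injOn_of_card_image_eq
  apply le_antisymm card_image_le
  have : (univ : Finset (Fin r)) ⊆ (nb G A x).image c := fun k _ => by
    simpa using exists_nb_color h c hc k
  simpa [hr] using card_le_card this

/-- The color of a neighbour `y` can be shifted to `x`. -/
theorem colOn_shift (h : ¬ ColOn G (insert x A) r) (hA : ColOn G A r) (hr : #(nb G A x) = r)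
    (hy : y ∈ nb G A x) : ColOn G ((insert x A).erase y) r := by
  obtain ⟨c, hc⟩ := hA
  have hinj := color_injOn h c hc hr
  by_contra hcon
  have hx : x ≠ y := (mem_nb.1 hy).2.ne
  rw [erase_insert_of_ne hx] at hcon
  obtain ⟨a, ha, hay⟩ := exists_nb_color hcon c
    (fun a ha b hb => hc a (mem_of_mem_erase ha) b (mem_of_mem_erase hb)) (c y)
  rw [mem_nb, mem_erase] at ha
  exact ha.1.1 (hinj (mem_coe.2 (mem_nb.2 ⟨ha.1.2, ha.2⟩)) hy hay)

/-- Otherwise swapping the colors of `y` and `z` on the component of `y` alone would give two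
neighbours of `x` the same color, against `color_injOn`. -/
theorem conn_nb (h : ¬ ColOn G (insert x A) r) (hA : ColOn G A r) (hr : #(nb G A x) = r)
    (hy : y ∈ nb G A x) (hz : z ∈ nb G A x) : Conn G A y z := by
  by_contra hyz
  obtain ⟨c, hc⟩ := hA
  let c' : V → Fin r := fun v => if Conn G A y v then Equiv.swap (c y) (c z) (c v) else c v
  have hc' : ∀ a ∈ A, ∀ b ∈ A, G.Adj a b → c' a ≠ c' b := by
    intro a ha b hb hab
    have hiff : Conn G A y a ↔ Conn G A y b :=
      ⟨fun h => h.trans (.single ha hb hab), fun h => h.trans (.single hb ha hab.symm)⟩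
    simp only [c', hiff]
    split_ifs
    · exact fun h => hc a ha b hb hab ((Equiv.swap (c y) (c z)).injective h)
    · exact hc a ha b hb hab
  have heq : c' y = c' z := by
    simp only [c', hyz, if_false]
    rw [if_pos (show Conn G A y y from .refl), Equiv.swap_apply_left]
  have := color_injOn h c' hc' hr hy hz heq
  exact hyz (this ▸ .refl)

/-- `V` is partitioned into `A`, `B` and `{x}`, with `G[A]` `r`-colorable, `G[B]` `s`-colorable. -/
structure Split (G : SimpleGraph V) (r s : ℕ) (A B : Finset V) (x : V) : Prop where
  notA : x ∉ A
  notB : x ∉ B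
  disj : ∀ a ∈ A, a ∉ B
  cover : ∀ a, a = x ∨ a ∈ A ∨ a ∈ B
  colA : ColOn G A r
  colB : ColOn G B s

theorem Split.swap (S : Split G r s A B x) : Split G s r B A x :=
  ⟨S.notB, S.notA, fun a hb ha => S.disj a ha hb, fun a => (S.cover a).imp_right Or.symm,
    S.colB, S.colA⟩

variable [Fintype V]

/-- The hypotheses on `G`, with the number of colors split as `d = r + s`. -/
structure OreHyp (G : SimpleGraph V) (d r s : ℕ) : Prop where
  not_col : ¬ ColOn G univ d
  ore : ∀ u v, G.Adj u v → dg G u + dg G v ≤ 2 * d + 1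
  sum : r + s = d
  two_le_r : 2 ≤ r
  two_le_s : 2 ≤ s

theorem OreHyp.swap (H : OreHyp G d r s) : OreHyp G d s r :=
  ⟨H.not_col, H.ore, by rw [add_comm]; exact H.sum, H.two_le_s, H.two_le_r⟩

theorem Split.not_colOn (H : OreHyp G d r s) (S : Split G r s A B x) :
    ¬ ColOn G (insert x A) r := by
  intro h
  apply H.not_col
  rw [← H.sum]
  refine (h.union S.colB).mono fun a _ => ?_
  have := S.cover a
  simp only [mem_union, mem_insert]
  tauto

theorem Split.le_card (H : OreHyp G d r s) (S : Split G r s A B x) : r ≤ #(nb G A x) :=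
  le_card_nb (S.not_colOn H) S.colA

theorem Split.dg_eq (S : Split G r s A B x) (v : V) (hv : ¬ G.Adj v x) :
    dg G v = #(nb G A v) + #(nb G B v) := by
  rw [dg, ← card_union_of_disjoint]
  · congr 1
    ext a
    simp only [mem_nb, mem_univ, true_and, mem_union]
    constructor
    · intro h
      rcases S.cover a with rfl | h' | h'
      · exact (hv h).elim
      · exact .inl ⟨h', h⟩
      · exact .inr ⟨h', h⟩
    · rintro (h | h) <;> exact h.2
  · rw [disjoint_left]
    exact fun a h1 h2 => S.disj a (mem_nb.1 h1).1 (mem_nb.1 h2).1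

theorem Split.card_eq (H : OreHyp G d r s) (S : Split G r s A B x) (hx : dg G x ≤ d) :
    #(nb G A x) = r := by
  have h1 := S.le_card H
  have h2 := S.swap.le_card H.swap
  have h3 := S.dg_eq x (G.irrefl)
  have := H.sum
  omega

theorem Split.le_dg (H : OreHyp G d r s) (S : Split G r s A B x) : d ≤ dg G x := by
  have h1 := S.le_card H
  have h2 := S.swap.le_card H.swap
  have h3 := S.dg_eq x (G.irrefl)
  have := H.sum
  omega

theorem Split.shift (H : OreHyp G d r s) (S : Split G r s A B x) (hr : #(nb G A x) = r)
    (hy : y ∈ nb G A x) : Split G r s ((insert x A).erase y) B y where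
  notA := notMem_erase _ _
  notB := S.disj y (mem_nb.1 hy).1
  disj a ha := by
    rcases mem_insert.1 (mem_of_mem_erase ha) with rfl | h
    · exact S.notB
    · exact S.disj a h
  cover a := by
    have := S.cover a
    simp only [mem_erase, mem_insert]
    tauto
  colA := colOn_shift (S.not_colOn H) S.colA hr hy
  colB := S.colB

/-- A split at a vertex `x` of degree at most `d` with the fewest edges in the parts, weighted. -/
structure MinSplit (G : SimpleGraph V) (d r s : ℕ) (A B : Finset V) (x : V) : Prop
    extends Split G r s A B x where
  low : dg G x ≤ d
  min : ∀ A' B' x', Split G r s A' B' x' → dg G x' ≤ d →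
    s * edg G A + r * edg G B ≤ s * edg G A' + r * edg G B'

theorem MinSplit.swap (S : MinSplit G d r s A B x) : MinSplit G d s r B A x :=
  ⟨S.toSplit.swap, S.low, fun A' B' x' h h' => by
    have := S.min B' A' x' h.swap h'
    omega⟩

theorem MinSplit.card_eq (H : OreHyp G d r s) (S : MinSplit G d r s A B x) : #(nb G A x) = r :=
  S.toSplit.card_eq H S.low

/-- In a minimal split the component of `x` in `A + x` is `r`-regular, and each of its vertices can
take over the role of `x`. -/
theorem MinSplit.regular (H : OreHyp G d r s) (S : MinSplit G d r s A B x)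
    (h : Conn G (insert x A) x y) :
    #(nb G (insert x A) y) = r ∧ Split G r s ((insert x A).erase y) B y := by
  induction h with
  | refl =>
    rw [nb_insert_self S.notA, erase_insert S.notA]
    exact ⟨S.card_eq H, S.toSplit⟩
  | @tail b c _ h ih =>
    obtain ⟨hb, hc, hbc⟩ := h
    obtain ⟨ih1, ih2⟩ := ih
    have hcb : c ∈ nb G ((insert x A).erase b) b := mem_nb.2 ⟨mem_erase.2 ⟨hbc.ne', hc⟩, hbc⟩
    have S' := ih2.shift H (by rw [nb_erase_self]; exact ih1) hcb
    rw [insert_erase hb] at S'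
    refine ⟨?_, S'⟩
    have h1 := S'.le_card H
    have h2 := S'.swap.le_card H.swap
    have h3 := S'.dg_eq c (G.irrefl)
    have h4 := H.ore b c hbc
    have h5 := ih2.le_dg H
    have hsum := H.sum
    rw [nb_erase_self] at h1 h3
    by_contra hne
    -- Since `b` has degree at least `d`, `c` has degree at most `d + 1`; so the excess over `r + s`
    -- is exactly one and lies on the `A`-side. Thus `c` is high and its neighbour `e` in `B` is
    -- low. Moving `c` into `B` and `e` out loses an edge in `A` and gains none in `B`,
    -- contradicting minimality.
    have hB : #(nb G B c) = s := by omega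
    have hU : #(nb G (insert x A) c) = r + 1 := by omega
    obtain ⟨e, he⟩ : (nb G B c).Nonempty := by
      rw [← card_pos, hB]; have := H.two_le_s; omega
    have S'' := (S'.swap.shift H.swap hB he).swap
    have hlow : dg G e ≤ d := by
      have := H.ore c e (mem_nb.1 he).2
      omega
    have hmin := S.min _ _ _ S'' hlow
    have e1 := edg_erase (G := G) hc
    have e2 := edg_insert (G := G) S.notA
    have e3 := edg_insert (G := G) S'.notB
    have e4 := edg_erase (G := G) (mem_insert_of_mem (mem_nb.1 he).1 : e ∈ insert c B)
    have h6 := S''.swap.le_card H.swap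
    rw [nb_erase_self] at h6
    rw [S.card_eq H] at e2
    have h7 : edg G ((insert x A).erase c) + 2 = edg G A := by omega
    have h8 : edg G ((insert c B).erase e) ≤ edg G B := by omega
    have h9 := Nat.mul_le_mul_left r h8
    rw [← h7, mul_add] at hmin
    have := H.two_le_s
    omega

theorem MinSplit.shift (H : OreHyp G d r s) (S : MinSplit G d r s A B x)
    (h : Conn G (insert x A) x y) (hy : dg G y ≤ d) :
    MinSplit G d r s ((insert x A).erase y) B y := by
  obtain ⟨h1, h2⟩ := S.regular H h
  refine ⟨h2, hy, ?_⟩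
  have e1 := edg_erase (G := G) (h.mem (mem_insert_self _ _))
  have e2 := edg_insert (G := G) S.notA
  rw [S.card_eq H] at e2
  have : edg G ((insert x A).erase y) = edg G A := by omega
  rw [this]
  exact S.min

theorem MinSplit.conn (H : OreHyp G d r s) (S : MinSplit G d r s A B x)
    (hy : y ∈ nb G A x) (hz : z ∈ nb G A x) : Conn G A y z :=
  conn_nb (S.not_colOn H) S.colA (S.card_eq H) hy hz

/-- By regularity of the component in `A + x`, a degree deficit in `A` can only come from the
deletion of `x`. So the neighbours of `x` in that component are determined by `A` alone. -/
theorem MinSplit.mem_of_card_lt (H : OreHyp G d r s) (S : MinSplit G d r s A B x)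
    (hy : y ∈ nb G A x) (h : Conn G A y z) (hz : #(nb G A z) < r) : z ∈ nb G A x := by
  have := (S.regular H (h.to_insert hy)).1
  rw [card_nb_insert S.notA] at this
  refine mem_nb.2 ⟨h.mem (mem_nb.1 hy).1, ?_⟩
  by_contra hadj
  rw [if_neg fun h => hadj h.symm] at this
  omega

theorem MinSplit.card_lt (H : OreHyp G d r s) (S : MinSplit G d r s A B x)
    (hy : y ∈ nb G A x) : #(nb G A y) < r := by
  have := (S.regular H (Conn.to_insert hy .refl)).1
  rw [card_nb_insert S.notA, if_pos (mem_nb.1 hy).2.symm] at this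
  omega

/-- Two vertices with neighbours in the same component of `A` have the same neighbours there. -/
theorem MinSplit.nb_eq {B' : Finset V} {x' y' : V} (H : OreHyp G d r s)
    (S : MinSplit G d r s A B x) (S' : MinSplit G d r s A B' x')
    (hy : y ∈ nb G A x) (hy' : y' ∈ nb G A x') (h : Conn G A y y') : nb G A x = nb G A x' := by
  ext a
  constructor
  · intro ha
    exact S'.mem_of_card_lt H hy' (h.symm.trans (S.conn H hy ha)) (S.card_lt H ha)
  · intro ha
    exact S.mem_of_card_lt H hy (h.trans (S'.conn H hy' ha)) (S'.card_lt H ha)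

theorem OreHyp.low_or_low (H : OreHyp G d r s) {u v : V} (h : G.Adj u v) :
    dg G u ≤ d ∨ dg G v ≤ d := by
  have := H.ore u v h
  omega

/-- The component of `x` in `A + x` contains two adjacent vertices of degree at most `d`, the first
of which is not `x`. -/
theorem MinSplit.exists_low_edge (H : OreHyp G d r s) (S : MinSplit G d r s A B x) :
    ∃ y ∈ A, dg G y ≤ d ∧ Conn G (insert x A) x y ∧
      ∃ u ∈ insert x A, G.Adj y u ∧ dg G u ≤ d := by
  by_contra! hcon
  -- Without such an edge, low versus high is a proper 2-coloring of the component of `x`, and `2 ≤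
  -- r`.
  apply S.not_colOn H
  obtain ⟨c, hc⟩ := S.colA
  have hr := H.two_le_r
  refine ⟨fun v => if Conn G (insert x A) x v then
    (if dg G v ≤ d then ⟨0, by omega⟩ else ⟨1, by omega⟩) else c v, ?_⟩
  intro a ha b hb hab
  have hiff : Conn G (insert x A) x a ↔ Conn G (insert x A) x b :=
    ⟨fun h => h.trans (.single ha hb hab), fun h => h.trans (.single hb ha hab.symm)⟩
  have hl := H.low_or_low hab
  by_cases hC : Conn G (insert x A) x b
  · simp only [hiff, hC, if_true]
    by_cases h1 : dg G a ≤ d <;> by_cases h2 : dg G b ≤ d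
    · exfalso
      rcases mem_insert.1 ha with rfl | ha'
      · exact absurd h1 (not_le.2 (hcon b ((mem_insert.1 hb).resolve_left hab.ne') h2 hC a ha
          hab.symm))
      · exact absurd h2 (not_le.2 (hcon a ha' h1 (hiff.2 hC) b hb hab))
    · simp [h1, h2]
    · simp [h1, h2]
    · tauto
  · simp only [hiff, hC, if_false]
    have hax : a ≠ x := fun h => hC (hiff.1 (h ▸ .refl))
    have hbx : b ≠ x := fun h => hC (h ▸ .refl)
    exact hc a ((mem_insert.1 ha).resolve_left hax) b ((mem_insert.1 hb).resolve_left hbx) hab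

end Basic

/-! ### Moving vertices until a low triangle straddles the split. -/

section Moving

open Finset
open scoped Classical

variable {V : Type*} [Fintype V] {G : SimpleGraph V} {d r s : ℕ} {A B F : Finset V} {w x y z v : V}

/-- Three vertices of low degree, two on one side and one on the other. -/
structure Triple (G : SimpleGraph V) (d r s : ℕ) (A B : Finset V) (x v z : V) : Prop where
  min : MinSplit G d r s A B x
  mem_v : v ∈ nb G A x
  mem_z : z ∈ nb G B x
  adj : G.Adj v z
  low_v : dg G v ≤ d
  low_z : dg G z ≤ d

theorem Triple.swap (T : Triple G d r s A B x v z) : Triple G d s r B A x z v :=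
  ⟨T.min.swap, T.mem_z, T.mem_v, T.adj.symm, T.low_z, T.low_v⟩

/-- The vertices of a triple have the same closed neighbourhood. -/
theorem Triple.twin_v (H : OreHyp G d r s) (T : Triple G d r s A B x v z) (u : V) :
    (u = x ∨ G.Adj x u) ↔ (u = v ∨ G.Adj v u) := by
  obtain ⟨S, hv, hz, hvz, lv, lz⟩ := T
  have hvA := (mem_nb.1 hv).1
  have hxv := (mem_nb.1 hv).2
  have hzB := (mem_nb.1 hz).1
  have hxz := (mem_nb.1 hz).2
  have hvz' : v ≠ z := hvz.ne
  have hxv' : x ≠ v := hxv.ne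
  have hxz' : x ≠ z := hxz.ne
  -- Each of `x`, `v`, `z` can be the removed vertex, and any two of them share the third as a
  -- neighbour, so `MinSplit.nb_eq` compares their neighbourhoods side by side.
  have Sv := S.shift H (Conn.to_insert hv .refl) lv
  have hB : nb G B x = nb G B v :=
    S.swap.nb_eq H.swap Sv.swap hz (mem_nb.2 ⟨hzB, hvz⟩) .refl
  have Sz := (S.swap.shift H.swap (Conn.to_insert hz .refl) lz).swap
  have hA : nb G A x = nb G A z := S.nb_eq H Sz hv (mem_nb.2 ⟨hvA, hvz.symm⟩) .refl
  have hzBv : z ∈ nb G B v := mem_nb.2 ⟨hzB, hvz⟩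
  have Svz := (Sv.swap.shift H.swap (Conn.to_insert hzBv .refl) lz).swap
  have hxA' : x ∈ (insert x A).erase v := mem_erase.2 ⟨hxv', mem_insert_self _ _⟩
  have hA' : nb G ((insert x A).erase v) v = nb G ((insert x A).erase v) z :=
    Sv.nb_eq H Svz (mem_nb.2 ⟨hxA', hxv.symm⟩) (mem_nb.2 ⟨hxA', hxz.symm⟩) .refl
  have eA := Finset.ext_iff.1 hA u
  have eA' := Finset.ext_iff.1 hA' u
  have eB := Finset.ext_iff.1 hB u
  simp only [mem_nb, mem_erase, mem_insert] at eA eA' eB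
  by_cases hux : u = x
  · subst hux
    simp [hxv.symm]
  by_cases huv : u = v
  · subst huv
    simp [hxv]
  rcases S.cover u with h | h | h
  · exact absurd h hux
  · simp only [h, hux, huv, or_true, true_and, ne_eq, not_false_eq_true, false_or] at eA eA' ⊢
    rw [eA, eA']
  · simp only [h, true_and] at eB
    simp only [hux, huv, false_or, eB]

theorem Triple.twin_z (H : OreHyp G d r s) (T : Triple G d r s A B x v z) (u : V) :
    (u = x ∨ G.Adj x u) ↔ (u = z ∨ G.Adj z u) :=
  T.swap.twin_v H.swap u

/-- All neighbours of `x` of low degree have the same closed neighbourhood as `x`. -/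
theorem Triple.twin (H : OreHyp G d r s) (T : Triple G d r s A B x v z) {u : V}
    (hu : G.Adj x u) (lu : dg G u ≤ d) (t : V) :
    (t = x ∨ G.Adj x t) ↔ (t = u ∨ G.Adj u t) := by
  rcases T.min.cover u with rfl | h | h
  · exact (G.irrefl hu).elim
  · by_cases huz : u = z
    · subst huz
      exact T.twin_z H t
    have hz := ((T.twin_z H u).1 (.inr hu)).resolve_left huz
    exact Triple.twin_v H
      ⟨T.min, mem_nb.2 ⟨h, hu⟩, T.mem_z, hz.symm, lu, T.low_z⟩ t
  · by_cases huv : u = v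
    · subst huv
      exact T.twin_v H t
    have hv := ((T.twin_v H u).1 (.inr hu)).resolve_left huv
    exact Triple.twin_z H
      ⟨T.min, T.mem_v, mem_nb.2 ⟨h, hu⟩, hv, T.low_v, lu⟩ t

/-- A certificate that no vertex can be moved into the component of `a` in `A`. -/
def Dead (G : SimpleGraph V) (d r s : ℕ) (A B F : Finset V) (a : V) : Prop :=
  ∃ v, dg G v ≤ d ∧ Conn G A a v ∧ #(nb G A v) < r ∧
    ∃ u ∈ B, u ∈ F ∧ G.Adj v u ∧ #{b ∈ nb G B v | Conn G B u b} ≠ s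

/-- The state of the vertex-moving process: `w` has just left the `B`-side, and `F` consists of the
components vacated so far. -/
structure Inv (G : SimpleGraph V) (d r s : ℕ) (A B F : Finset V) (w : V) : Prop where
  min : MinSplit G d r s A B w
  notMem : w ∉ F
  closedA : ∀ a ∈ F, a ∈ A → ∀ b ∈ A, G.Adj a b → b ∈ F
  closedB : ∀ a ∈ F, a ∈ B → ∀ b ∈ B, G.Adj a b → b ∈ F
  nb_subset : nb G B w ⊆ F
  low : ∃ v ∈ nb G B w, dg G v ≤ d
  deadA : ∀ a ∈ F, a ∈ A → Dead G d r s A B F a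
  deadB : ∀ a ∈ F, a ∈ B → Dead G d s r B A F a ∨ ∃ b ∈ nb G B w, Conn G B b a

/-- If `w` entered a vacated component, the vertex `v` of its certificate would be a neighbour of
`w` and could be moved out. Then all `s` neighbours of `v` in `B` would lie in one component, which
the certificate denies. -/
theorem Inv.notMem_nb (H : OreHyp G d r s) (I : Inv G d r s A B F w) {a : V}
    (ha : a ∈ nb G A w) : a ∉ F := by
  intro haF
  obtain ⟨v, lv, hav, hv, u, hu, -, hvu, hcard⟩ := I.deadA a haF (mem_nb.1 ha).1
  have S := I.min
  have hvw := S.mem_of_card_lt H ha hav hv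
  have Sv := S.shift H (Conn.to_insert hvw .refl) lv
  have hu' : u ∈ nb G B v := mem_nb.2 ⟨hu, hvu⟩
  apply hcard
  rw [filter_true_of_mem fun b hb => Sv.swap.conn H.swap hu' hb]
  exact Sv.swap.card_eq H.swap

/-- If `w` moves to `A` and `y` is moved out, then no vertex can return to the component that `w`
left. -/
theorem dead_of_move (H : OreHyp G d r s) (hT : ∀ v z, ¬ Triple G d r s A B w z v)
    (S : MinSplit G d r s A B w) (hv : v ∈ nb G B w) (lv : dg G v ≤ d)
    (hy : y ∈ A) (ly : dg G y ≤ d) :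
    #{b ∈ nb G ((insert w A).erase y) v | Conn G ((insert w A).erase y) w b} ≠ r := by
  obtain ⟨hvB, hwv⟩ := mem_nb.1 hv
  have hwy : w ≠ y := fun h => S.notA (h ▸ hy)
  have hw' : w ∈ (insert w A).erase y := mem_erase.2 ⟨hwy, mem_insert_self _ _⟩
  have hsub : (insert w A).erase y ⊆ insert w A := erase_subset _ _
  -- If `v` has a neighbour in the component entered by `w`, then `v` and `w` have the same
  -- neighbours in `A`; `y` is not among them for lack of a triple, so the count is at least `r +
  -- 1`. If not, only `w` can be counted, and `1 < r`.
  by_cases hcase : ∃ a ∈ nb G A v, ∃ b ∈ nb G A w, Conn G A b a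
  · obtain ⟨a, ha, b, hb, hba⟩ := hcase
    have Sv := (S.swap.shift H.swap (Conn.to_insert hv .refl) lv).swap
    have heq := S.nb_eq H Sv hb ha hba
    have hyv : y ∉ nb G A w := fun hyw =>
      hT v y ⟨S, hyw, hv, (mem_nb.1 (heq ▸ hyw : y ∈ nb G A v)).2.symm, ly, lv⟩
    have hss : insert w (nb G A w) ⊆
        {b ∈ nb G ((insert w A).erase y) v | Conn G ((insert w A).erase y) w b} := by
      intro t ht
      rw [mem_filter]
      rcases mem_insert.1 ht with rfl | ht
      · exact ⟨mem_nb.2 ⟨hw', hwv.symm⟩, .refl⟩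
      · have hty : t ≠ y := fun h => hyv (h ▸ ht)
        have htm : t ∈ (insert w A).erase y :=
          mem_erase.2 ⟨hty, mem_insert_of_mem (mem_nb.1 ht).1⟩
        exact ⟨mem_nb.2 ⟨htm, (mem_nb.1 (heq ▸ ht : t ∈ nb G A v)).2⟩,
          .single hw' htm (mem_nb.1 ht).2⟩
    have := card_le_card hss
    rw [card_insert_of_notMem (fun h => G.irrefl (mem_nb.1 h).2), S.card_eq H] at this
    omega
  · have hss : {b ∈ nb G ((insert w A).erase y) v | Conn G ((insert w A).erase y) w b} ⊆ {w} := by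
      intro t ht
      obtain ⟨ht1, ht2⟩ := mem_filter.1 ht
      rw [mem_singleton]
      by_contra htw
      obtain ⟨ht3, ht4⟩ := mem_nb.1 ht1
      obtain ⟨b, hb, hbt⟩ := (ht2.mono hsub).of_insert.resolve_left htw
      exact hcase ⟨t, mem_nb.2 ⟨(mem_insert.1 (hsub ht3)).resolve_left htw, ht4⟩, b, hb, hbt⟩
    have := card_le_card hss
    have := H.two_le_r
    rw [card_singleton] at *
    omega

/-- The vertex `w` enters a fresh component of `A`, and a low `y` with a low neighbour in that
component leaves. The component now vacated contains `w`, which was not in `F`; the one `w` left on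
the `B`-side gets its certificate from `dead_of_move`. -/
theorem Inv.step (H : OreHyp G d r s) (hT : ∀ v z, ¬ Triple G d r s A B w z v)
    (I : Inv G d r s A B F w) :
    ∃ A' F' y, Inv G d s r B A' F' y ∧ F ⊂ F' := by
  have S := I.min
  obtain ⟨y, hyA, ly, hwy, u, hu, hyu, lu⟩ := S.exists_low_edge H
  have hne : w ≠ y := fun h => S.notA (h ▸ hyA)
  set A' := (insert w A).erase y with hA'
  have S' : MinSplit G d r s A' B y := S.shift H hwy ly
  have hsub : A' ⊆ insert w A := erase_subset _ _
  have hins : insert y A' = insert w A := insert_erase (mem_insert_of_mem hyA)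
  have hwA' : w ∈ A' := mem_erase.2 ⟨hne, mem_insert_self _ _⟩
  have hyF : y ∉ F := by
    intro hyF
    obtain ⟨a, ha, hay⟩ := hwy.of_insert.resolve_left hne.symm
    exact I.notMem_nb H ha (hay.symm.closed I.closedA hyF).1
  have hmemA : ∀ a ∈ F, a ∈ A' ↔ a ∈ A := by
    intro a ha
    have h1 : a ≠ w := fun h => I.notMem (h ▸ ha)
    have h2 : a ≠ y := fun h => hyF (h ▸ ha)
    simp [hA', h1, h2]
  have hclosed : ∀ a ∈ F, a ∈ A' → ∀ b ∈ A', G.Adj a b → b ∈ F := by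
    intro a ha haA b hb hab
    rw [hmemA a ha] at haA
    rcases mem_insert.1 (hsub hb) with rfl | hbA
    · exact (I.notMem_nb H (mem_nb.2 ⟨haA, hab.symm⟩) ha).elim
    · exact I.closedA a ha haA b hbA hab
  have hinter : A ∩ F = A' ∩ F := by
    ext a
    simp only [mem_inter]
    exact ⟨fun h => ⟨(hmemA a h.2).2 h.1, h.2⟩, fun h => ⟨(hmemA a h.2).1 h.1, h.2⟩⟩
  -- The move does not touch components inside `F`, so old certificates stay valid.
  have hconn : ∀ a ∈ F, ∀ b, Conn G A a b ↔ Conn G A' a b := by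
    intro a ha b
    constructor <;> intro h
    · exact (hinter ▸ (h.closed I.closedA ha).2).mono inter_subset_left
    · exact (hinter ▸ (h.closed hclosed ha).2).mono inter_subset_left
  have hnb : ∀ a ∈ F, a ∈ A → nb G A' a = nb G A a := by
    intro a ha haA
    ext b
    simp only [mem_nb]
    constructor <;> rintro ⟨hb, hab⟩
    · exact ⟨(hmemA b (hclosed a ha ((hmemA a ha).2 haA) b hb hab)).1 hb, hab⟩
    · exact ⟨(hmemA b (I.closedA a ha haA b hb hab)).2 hb, hab⟩
  let K : Finset V := {b | ∃ a ∈ nb G A' y, Conn G A' a b}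
  have hK : ∀ b, b ∈ K ↔ ∃ a ∈ nb G A' y, Conn G A' a b := fun b => by simp [K]
  have hKA : ∀ b ∈ K, b ∈ A' := by
    intro b hb
    obtain ⟨a, ha, hab⟩ := (hK b).1 hb
    exact hab.mem (mem_nb.1 ha).1
  have hwK : w ∈ K := by
    rw [hK]
    refine (Conn.of_insert ?_).resolve_left hne
    rw [hins]
    exact hwy.symm
  have hnK : ∀ a ∈ nb G A' y, a ∈ K := fun a ha => (hK a).2 ⟨a, ha, .refl⟩
  have hdead : ∀ a, Dead G d s r B A F a → Dead G d s r B A' (F ∪ K) a := by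
    rintro a ⟨v, lv, hav, hv, t, ht, htF, hvt, hcard⟩
    refine ⟨v, lv, hav, hv, t, (hmemA t htF).2 ht, mem_union_left _ htF, hvt, ?_⟩
    convert hcard using 2
    ext b
    simp only [mem_filter, mem_nb]
    rw [← hconn t htF]
    constructor <;> rintro ⟨⟨hb, hvb⟩, htb⟩
    · exact ⟨⟨(hmemA b (htb.closed I.closedA htF).1).1 hb, hvb⟩, htb⟩
    · exact ⟨⟨(hmemA b (htb.closed I.closedA htF).1).2 hb, hvb⟩, htb⟩
  refine ⟨A', F ∪ K, y, ⟨S'.swap, ?_, ?_, ?_, ?_, ?_, ?_, ?_⟩, ?_⟩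
  · rw [mem_union]
    rintro (h | h)
    · exact hyF h
    · exact notMem_erase _ _ (hKA _ h)
  · intro a ha haB b hb hab
    rcases mem_union.1 ha with h | h
    · exact mem_union_left _ (I.closedB a h haB b hb hab)
    · exact (S'.disj a (hKA a h) haB).elim
  · intro a ha haA b hb hab
    rcases mem_union.1 ha with h | h
    · exact mem_union_left _ (hclosed a h haA b hb hab)
    · obtain ⟨t, ht, hta⟩ := (hK a).1 h
      exact mem_union_right _ ((hK b).2 ⟨t, ht, hta.trans (.single haA hb hab)⟩)
  · exact fun a ha => mem_union_right _ (hnK a ha)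
  · exact ⟨u, mem_nb.2 ⟨mem_erase.2 ⟨hyu.ne', hu⟩, hyu⟩, lu⟩
  · intro a ha haB
    have haF : a ∈ F := (mem_union.1 ha).resolve_right fun h => S'.disj a (hKA a h) haB
    rcases I.deadB a haF haB with h | ⟨b, hb, hba⟩
    · exact hdead a h
    · obtain ⟨v, hv, lv⟩ := I.low
      refine ⟨v, lv, hba.symm.trans (S.swap.conn H.swap hb hv), S.swap.card_lt H.swap hv, w,
        hwA', mem_union_right _ hwK, (mem_nb.1 hv).2.symm, ?_⟩
      exact dead_of_move H hT S hv lv hyA ly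
  · intro a ha haA
    rcases mem_union.1 ha with h | h
    · left
      obtain ⟨v, lv, hav, hv, t, ht, htF, hvt, hcard⟩ := I.deadA a h ((hmemA a h).1 haA)
      have hvF := (hav.closed I.closedA h).1
      exact ⟨v, lv, (hconn a h v).1 hav, by rwa [hnb v hvF (hav.mem ((hmemA a h).1 haA))], t, ht,
        mem_union_left _ htF, hvt, hcard⟩
    · exact .inr ((hK a).1 h)
  · rw [ssubset_iff_of_subset subset_union_left]
    exact ⟨w, mem_union_right _ hwK, I.notMem⟩

theorem Inv.exists_triple (H : OreHyp G d r s) (I : Inv G d r s A B F w) :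
    ∃ r s A B x v z, OreHyp G d r s ∧ Triple G d r s A B x v z := by
  by_contra! hcon
  have key : ∀ n r s A B F w, OreHyp G d r s → Inv G d r s A B F w →
      n + #F = Fintype.card V → False := by
    intro n
    induction n using Nat.strong_induction_on with
    | _ n ih =>
      intro r s A B F w H I hn
      obtain ⟨A', F', y, I', hF⟩ := I.step H fun v z => hcon r s A B w z v H
      have h1 := card_lt_card hF
      have h2 := card_le_univ F'
      exact ih (Fintype.card V - #F') (by omega) s r B A' F' y H.swap I' (by omega)
  exact key (Fintype.card V - #F) r s A B F w H I (by have := card_le_univ F; omega)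

/-- After one move, the only vacated component is the one just left, for which no certificate is
required yet. -/
theorem MinSplit.exists_inv (H : OreHyp G d r s) (S : MinSplit G d r s A B x) :
    ∃ A' F y, Inv G d s r B A' F y := by
  obtain ⟨y, hyA, ly, hxy, u, hu, hyu, lu⟩ := S.exists_low_edge H
  set A' := (insert x A).erase y with hA'
  have S' : MinSplit G d r s A' B y := S.shift H hxy ly
  let K : Finset V := {b | ∃ a ∈ nb G A' y, Conn G A' a b}
  have hK : ∀ b, b ∈ K ↔ ∃ a ∈ nb G A' y, Conn G A' a b := fun b => by simp [K]
  have hKA : ∀ b ∈ K, b ∈ A' := by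
    intro b hb
    obtain ⟨a, ha, hab⟩ := (hK b).1 hb
    exact hab.mem (mem_nb.1 ha).1
  refine ⟨A', K, y, S'.swap, fun h => notMem_erase _ _ (hKA y h),
    fun a ha haB => (S'.disj a (hKA a ha) haB).elim, ?_, fun a ha => (hK a).2 ⟨a, ha, .refl⟩,
    ⟨u, mem_nb.2 ⟨mem_erase.2 ⟨hyu.ne', hu⟩, hyu⟩, lu⟩,
    fun a ha haB => (S'.disj a (hKA a ha) haB).elim, fun a ha _ => .inr ((hK a).1 ha)⟩
  intro a ha haA b hb hab
  obtain ⟨t, ht, hta⟩ := (hK a).1 ha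
  exact (hK b).2 ⟨t, ht, hta.trans (.single haA hb hab)⟩

theorem Split.exists_minSplit (S : Split G r s A B x) (hx : dg G x ≤ d) :
    ∃ A B x, MinSplit G d r s A B x := by
  have hex : ∃ n A B x, Split G r s A B x ∧ dg G x ≤ d ∧ s * edg G A + r * edg G B = n :=
    ⟨_, A, B, x, S, hx, rfl⟩
  obtain ⟨A', B', x', h1, h2, h3⟩ := Nat.find_spec hex
  refine ⟨A', B', x', h1, h2, fun A'' B'' x'' h1' h2' => ?_⟩
  rw [h3]
  exact Nat.find_min' hex ⟨A'', B'', x'', h1', h2', rfl⟩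

/-- A coloring of a vertex-deleted subgraph splits. -/
theorem exists_split (H : OreHyp G d r s) (h : ColOn G (univ.erase x) d) :
    ∃ A B, Split G r s A B x := by
  obtain ⟨c, hc⟩ := h
  have hr := H.two_le_r
  have hs := H.two_le_s
  have hd := H.sum
  -- The truncations only make the two colorings total; on their own parts they merely renumber the
  -- colors.
  refine ⟨({a | a ≠ x ∧ (c a : ℕ) < r} : Finset V), ({a | a ≠ x ∧ r ≤ (c a : ℕ)} : Finset V), by simp, by simp, ?_, ?_,
    ⟨fun v => ⟨min (c v) (r - 1), by omega⟩, ?_⟩, ⟨fun v => ⟨c v - r, by omega⟩, ?_⟩⟩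
  · simp only [mem_filter, mem_univ, true_and]
    omega
  · intro a
    simp only [mem_filter, mem_univ, true_and]
    have := lt_or_ge (c a : ℕ) r
    tauto
  · simp only [mem_filter, mem_univ, true_and, ne_eq, Fin.mk.injEq]
    intro a ha b hb hab heq
    have := hc a (by simp [ha.1]) b (by simp [hb.1]) hab
    rw [ne_eq, Fin.ext_iff] at this
    omega
  · simp only [mem_filter, mem_univ, true_and, ne_eq, Fin.mk.injEq]
    intro a ha b hb hab heq
    have := hc a (by simp [ha.1]) b (by simp [hb.1]) hab
    rw [ne_eq, Fin.ext_iff] at this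
    omega

/-- A vertex-critical graph has a triple. -/
theorem exists_triple (H : OreHyp G d r s) (h : ColOn G (univ.erase x) d) (hx : dg G x ≤ d) :
    ∃ r s A B x v z, OreHyp G d r s ∧ Triple G d r s A B x v z := by
  obtain ⟨A, B, S⟩ := exists_split H h
  obtain ⟨A, B, x, S⟩ := S.exists_minSplit hx
  obtain ⟨A', F, y, I⟩ := S.exists_inv H
  exact I.exists_triple H.swap

end Moving

/-! ### From a triple to a clique, and reduction to the vertex-critical case. -/

section Final

open Finset
open scoped Classical

variable {V : Type*} [Fintype V] {G : SimpleGraph V} {d r s : ℕ} {A B : Finset V} {x z v : V}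

/-- A set `N` cannot contain two vertices of high degree, if those of degree at most `d` all have
`N` as their closed neighbourhood. -/
theorem card_high_le_one (hd : 5 ≤ d) (hnc : ¬ ColOn G univ d)
    (ore : ∀ u v, G.Adj u v → dg G u + dg G v ≤ 2 * d + 1) {N : Finset V} (hN : #N = d + 1)
    (hxN : x ∈ N) (hcol : ColOn G (univ.erase x) d) (hx : dg G x = d)
    (htwin : ∀ u ∈ N, dg G u ≤ d → ∀ t, t ∈ N ↔ t = u ∨ G.Adj u t)
    (hlow : 3 ≤ #{u ∈ N | dg G u ≤ d}) : #{u ∈ N | ¬ dg G u ≤ d} ≤ 1 := by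
  by_contra hP
  rw [not_le] at hP
  set L := {u ∈ N | dg G u ≤ d} with hL
  set P := {u ∈ N | ¬ dg G u ≤ d} with hPdef
  have hLP : #L + #P = d + 1 := by rw [← hN]; exact card_filter_add_card_filter_not _
  have hind : ∀ a ∈ P, ∀ b ∈ P, ¬ G.Adj a b := by
    intro a ha b hb hab
    have := ore a b hab
    have := (mem_filter.1 ha).2
    have := (mem_filter.1 hb).2
    omega
  have hLN : ∀ a ∈ N, a ∉ L → a ∈ P := by
    intro a ha haL
    rw [hL, mem_filter, not_and] at haL
    exact mem_filter.2 ⟨ha, haL ha⟩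
  have hPL : ∀ a ∈ P, a ∉ L := fun a ha h => (mem_filter.1 ha).2 (mem_filter.1 h).2
  have hPLadj : ∀ a ∈ P, ∀ b ∈ L, G.Adj a b := by
    intro a ha b hb
    have hb' := mem_filter.1 hb
    exact (((htwin b hb'.1 hb'.2 a).1 (mem_filter.1 ha).1).resolve_left
      fun h => hPL a ha (h ▸ hb)).symm
  -- Vertices of `L` have outside neighbours only in `P`, and `#L + #P = d + 1`. A color repeated on
  -- `P` would leave `#L` colors free, enough to color all of `L`.
  have hinj : ∀ c : V → Fin d, (∀ a ∉ L, ∀ b ∉ L, G.Adj a b → c a ≠ c b) → Set.InjOn c P := by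
    intro c hc
    by_contra hcon
    have h1 : #(P.image c) < #P :=
      lt_of_le_of_ne card_image_le fun h => hcon (injOn_of_card_image_eq h)
    have h2 : #L ≤ #(P.image c)ᶜ := by
      rw [card_compl, Fintype.card_fin]
      omega
    obtain ⟨f⟩ := Function.Embedding.nonempty_of_card_le
      (show Fintype.card L ≤ Fintype.card ↥(P.image c)ᶜ by rwa [Fintype.card_coe, Fintype.card_coe])
    have hmix : ∀ a (ha : a ∈ L), ∀ b ∉ L, G.Adj a b → (f ⟨a, ha⟩ : Fin d) ≠ c b := by
      intro a ha b hb hab h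
      have ha' := mem_filter.1 ha
      have hbP := hLN b ((htwin a ha'.1 ha'.2 b).2 (.inr hab)) hb
      have := (f ⟨a, ha⟩).2
      rw [mem_compl, h] at this
      exact this (mem_image_of_mem c hbP)
    apply hnc
    refine ⟨fun v => if h : v ∈ L then f ⟨v, h⟩ else c v, ?_⟩
    intro a _ b _ hab
    by_cases ha : a ∈ L <;> by_cases hb : b ∈ L
    · simp only [ha, hb, dif_pos]
      intro h
      have := f.injective (Subtype.ext h)
      exact hab.ne (congrArg Subtype.val this)
    · simp only [ha, hb, dif_pos, dif_neg, not_false_eq_true]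
      exact hmix a ha b hb hab
    · simp only [ha, hb, dif_pos, dif_neg, not_false_eq_true]
      exact (hmix b hb a ha hab.symm).symm
    · simp only [ha, hb, dif_neg, not_false_eq_true]
      exact hc a ha b hb hab
  obtain ⟨c, hc'⟩ := hcol
  have hxL : x ∈ L := mem_filter.2 ⟨hxN, hx.le⟩
  have hc : ∀ a ∉ L, ∀ b ∉ L, G.Adj a b → c a ≠ c b := fun a ha b hb =>
    hc' a (mem_erase.2 ⟨fun h => ha (h ▸ hxL), mem_univ _⟩) b
      (mem_erase.2 ⟨fun h => hb (h ▸ hxL), mem_univ _⟩)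
  let out : V → Finset V := fun i => {t ∈ nb G univ i | t ∉ N}
  let seen : V → Finset (Fin d) := fun i => (out i).image c
  have hseen : ∀ i ∈ P, #(seen i) ≤ #P := by
    intro i hi
    have h1 : #L + #(out i) ≤ dg G i := by
      rw [← card_union_of_disjoint (disjoint_left.2 fun t h1 h2 =>
        (mem_filter.1 (show t ∈ {t ∈ nb G univ i | t ∉ N} from h2)).2 (mem_filter.1 h1).1)]
      apply card_le_card
      intro t ht
      rcases mem_union.1 ht with h | h
      · exact mem_nb.2 ⟨mem_univ _, hPLadj i hi t h⟩
      · exact (mem_filter.1 h).1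
    have h2 := ore i x (hPLadj i hi x hxL)
    have h3 : #(seen i) ≤ #(out i) := card_image_le
    omega
  -- As `P` is independent, its vertices may be recolored simultaneously with any color unseen
  -- outside `N`; the result must again be injective on `P`.
  have hrecol : ∀ S ⊆ P, ∀ k : Fin d, (∀ i ∈ S, k ∉ seen i) →
      Set.InjOn (fun t => if t ∈ S then k else c t) P := by
    intro S hS k hk
    have hmix : ∀ a ∈ S, ∀ b ∉ L, G.Adj a b → k ≠ c b := by
      intro a ha b hb hab h
      apply hk a ha
      rw [h]
      refine mem_image_of_mem c (mem_filter.2 ⟨mem_nb.2 ⟨mem_univ _, hab⟩, fun hbN => ?_⟩)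
      exact hind a (hS ha) b (hLN b hbN hb) hab
    apply hinj
    intro a ha b hb hab
    by_cases haS : a ∈ S <;> by_cases hbS : b ∈ S
    · exact (hind a (hS haS) b (hS hbS) hab).elim
    · simpa [haS, hbS] using hmix a haS b hb hab
    · simpa [haS, hbS] using (hmix b hbS a ha hab.symm).symm
    · simpa [haS, hbS] using hc a ha b hb hab
  have hpair : ∀ i ∈ P, ∀ j ∈ P, i ≠ j → ∀ k, k ∈ seen i ∨ k ∈ seen j := by
    intro i hi j hj hij k
    by_contra! hk
    refine hij (hrecol {i, j} ?_ k ?_ hi hj ?_)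
    · intro t ht
      rcases mem_insert.1 ht with rfl | ht
      · exact hi
      · rwa [mem_singleton.1 ht]
    · intro t ht
      rcases mem_insert.1 ht with rfl | ht
      · exact hk.1
      · rw [mem_singleton.1 ht]; exact hk.2
    · simp
  have hsee : ∀ i ∈ P, ∀ j ∈ P, i ≠ j → c j ∈ seen i := by
    intro i hi j hj hij
    by_contra hk
    refine hij (hrecol {i} (by simpa using hi) (c j) (by simpa using hk) hi hj ?_)
    simp [hij.symm]
  let U : Finset (Fin d) := (P.image c)ᶜ
  have hU : #U = d - #P := by
    rw [card_compl, Fintype.card_fin, card_image_of_injOn (hinj c hc)]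
  -- Of the at most `#P` colors seen by `i`, the other vertices of `P` account for `#P - 1`.
  have hone : ∀ i ∈ P, #(seen i ∩ U) ≤ 1 := by
    intro i hi
    have h1 : #((P.erase i).image c ∪ (seen i ∩ U)) ≤ #(seen i) := by
      apply card_le_card
      intro k hk
      rcases mem_union.1 hk with h | h
      · obtain ⟨j, hj, rfl⟩ := mem_image.1 h
        exact hsee i hi j (mem_of_mem_erase hj) (ne_of_mem_erase hj).symm
      · exact (mem_inter.1 h).1
    rw [card_union_of_disjoint, card_image_of_injOn
      ((hinj c hc).mono (coe_subset.2 (erase_subset _ _))), card_erase_of_mem hi] at h1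
    · have := hseen i hi
      omega
    · rw [disjoint_left]
      intro k h2 h3
      exact mem_compl.1 (mem_inter.1 h3).2 (image_subset_image (erase_subset _ _) h2)
  have hunion : ∀ i ∈ P, ∀ j ∈ P, i ≠ j → #U ≤ 2 := by
    intro i hi j hj hij
    have : U ⊆ (seen i ∩ U) ∪ (seen j ∩ U) := by
      intro k hk
      rcases hpair i hi j hj hij k with h | h <;> simp [h, hk]
    have h1 := (card_le_card this).trans (card_union_le _ _)
    have := hone i hi
    have := hone j hj
    omega
  obtain ⟨i, hi, j, hj, hij⟩ := one_lt_card.1 hP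
  have hU2 := hunion i hi j hj hij
  -- Here `5 ≤ d` enters: `d - #P ≤ 2` gives `#P ≥ 3`, while `3 ≤ #L` gives two colors in `U`. Each
  -- is missed by at most one of three vertices, yet no vertex sees both.
  obtain ⟨i, j, k, hi, hj, hk, hij, hik, hjk⟩ := two_lt_card_iff.1 (show 2 < #P by omega)
  obtain ⟨α, hα, β, hβ, hαβ⟩ := one_lt_card.1 (show 1 < #U by omega)
  have hnot : ∀ i ∈ P, ¬ (α ∈ seen i ∧ β ∈ seen i) := fun i hi h =>
    hαβ (card_le_one.1 (hone i hi) α (mem_inter.2 ⟨h.1, hα⟩) β (mem_inter.2 ⟨h.2, hβ⟩))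
  have a1 := hpair i hi j hj hij α
  have a2 := hpair i hi k hk hik α
  have a3 := hpair j hj k hk hjk α
  have b1 := hpair i hi j hj hij β
  have b2 := hpair i hi k hk hik β
  have b3 := hpair j hj k hk hjk β
  have n1 := hnot i hi
  have n2 := hnot j hj
  have n3 := hnot k hk
  rcases a1 with h | h
  · have hb : β ∉ seen i := fun h' => n1 ⟨h, h'⟩
    exact a3.elim (fun h' => n2 ⟨h', b1.resolve_left hb⟩) fun h' => n3 ⟨h', b2.resolve_left hb⟩
  · have hb : β ∉ seen j := fun h' => n2 ⟨h, h'⟩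
    exact a2.elim (fun h' => n1 ⟨h', b1.resolve_right hb⟩) fun h' => n3 ⟨h', b3.resolve_left hb⟩

theorem Triple.exists_clique (hd : 5 ≤ d) (H : OreHyp G d r s) (T : Triple G d r s A B x v z) :
    ∃ N : Finset V, G.IsNClique (d + 1) N := by
  have hx : dg G x = d := le_antisymm T.min.low (T.min.toSplit.le_dg H)
  have hmem : ∀ t, t ∈ insert x (nb G univ x) ↔ t = x ∨ G.Adj x t := by
    intro t
    simp [mem_nb]
  have hcard : #(insert x (nb G univ x)) = d + 1 := by
    rw [card_insert_of_notMem fun h => G.irrefl (mem_nb.1 h).2]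
    exact congrArg (· + 1) hx
  have htwin : ∀ u ∈ insert x (nb G univ x), dg G u ≤ d →
      ∀ t, t ∈ insert x (nb G univ x) ↔ t = u ∨ G.Adj u t := by
    intro u hu lu t
    rw [hmem]
    rcases (hmem u).1 hu with rfl | hu
    · rfl
    · exact T.twin H hu lu t
  have hcol : ColOn G (univ.erase x) d := by
    rw [← H.sum]
    refine (T.min.colA.union T.min.colB).mono fun a ha => ?_
    have := T.min.cover a
    have := ne_of_mem_erase ha
    rw [mem_union]
    tauto
  have hxv := (mem_nb.1 T.mem_v).2
  have hxz := (mem_nb.1 T.mem_z).2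
  have hlow : 3 ≤ #{u ∈ insert x (nb G univ x) | dg G u ≤ d} := by
    refine two_lt_card_iff.2 ⟨x, v, z, ?_, ?_, ?_, hxv.ne, hxz.ne, T.adj.ne⟩
    · exact mem_filter.2 ⟨mem_insert_self _ _, hx.le⟩
    · exact mem_filter.2 ⟨(hmem v).2 (.inr hxv), T.low_v⟩
    · exact mem_filter.2 ⟨(hmem z).2 (.inr hxz), T.low_z⟩
  have hhigh := card_high_le_one hd H.not_col H.ore hcard (mem_insert_self _ _) hcol hx htwin hlow
  refine ⟨_, ⟨?_, hcard⟩⟩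
  intro a ha b hb hab
  by_cases la : dg G a ≤ d
  · exact ((htwin a ha la b).1 hb).resolve_left hab.symm
  by_cases lb : dg G b ≤ d
  · exact (((htwin b hb lb a).1 ha).resolve_left hab).symm
  exact (hab (card_le_one.1 hhigh a (mem_filter.2 ⟨ha, la⟩) b (mem_filter.2 ⟨hb, lb⟩))).elim

theorem exists_clique_of_vertexCritical (hd : 5 ≤ d) (hnc : ¬ ColOn G univ d)
    (ore : ∀ u v, G.Adj u v → dg G u + dg G v ≤ 2 * d + 1)
    (hcrit : ∀ x, ColOn G (univ.erase x) d) : ∃ N : Finset V, G.IsNClique (d + 1) N := by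
  have H : OreHyp G d 2 (d - 2) := ⟨hnc, ore, by omega, le_rfl, by omega⟩
  obtain ⟨x, hx⟩ : ∃ x, dg G x ≤ d := by
    by_contra! hcon
    refine hnc ⟨fun _ => ⟨0, by omega⟩, fun a _ b _ hab => ?_⟩
    have := hcon a
    have := hcon b
    have := ore a b hab
    omega
  obtain ⟨r, s, A, B, x, v, z, H', T⟩ := exists_triple H (hcrit x) hx
  exact T.exists_clique hd H'

theorem exists_clique (hd : 5 ≤ d) (hnc : ¬ ColOn G univ d)
    (ore : ∀ u v, G.Adj u v → dg G u + dg G v ≤ 2 * d + 1) :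
    ∃ N : Finset V, G.IsNClique (d + 1) N := by
  -- A smallest non-colorable vertex set induces a vertex-critical graph, and degrees only drop.
  obtain ⟨W, hW, hmin⟩ := ({W | ¬ ColOn G W d} : Finset (Finset V)).exists_min_image card
    ⟨univ, by simpa using hnc⟩
  simp only [mem_filter, mem_univ, true_and] at hW hmin
  let G' : SimpleGraph W := G.comap Subtype.val
  have hdg : ∀ u : W, dg G' u ≤ dg G u := by
    intro u
    apply card_le_card_of_injOn Subtype.val
    · intro t ht
      exact mem_nb.2 ⟨mem_univ _, (mem_nb.1 ht).2⟩
    · exact Subtype.val_injective.injOn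
  have hnc' : ¬ ColOn G' univ d := by
    rintro ⟨c, hc⟩
    refine hW ⟨fun v => if h : v ∈ W then c ⟨v, h⟩ else ⟨0, by omega⟩, fun a ha b hb hab => ?_⟩
    simp only [ha, hb, dif_pos]
    exact hc ⟨a, ha⟩ (mem_univ _) ⟨b, hb⟩ (mem_univ _) hab
  have hcrit : ∀ x, ColOn G' (univ.erase x) d := by
    intro x
    have : ColOn G (W.erase x) d := by
      by_contra h
      have := hmin _ h
      have := card_erase_lt_of_mem x.2
      omega
    obtain ⟨c, hc⟩ := this
    refine ⟨fun v => c v, fun a ha b hb hab => ?_⟩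
    exact hc a (mem_erase.2 ⟨fun h => ne_of_mem_erase ha (Subtype.ext h), a.2⟩) b
      (mem_erase.2 ⟨fun h => ne_of_mem_erase hb (Subtype.ext h), b.2⟩) hab
  obtain ⟨N, hN⟩ := exists_clique_of_vertexCritical hd hnc'
    (fun u v huv => by
      have := ore u v huv
      have := hdg u
      have := hdg v
      omega) fun x => by convert hcrit x
  refine ⟨N.map (Function.Embedding.subtype _), ?_, by rw [card_map]; exact hN.2⟩
  intro a ha b hb hab
  obtain ⟨a, haN, rfl⟩ := mem_map.1 (mem_coe.1 ha)
  obtain ⟨b, hbN, rfl⟩ := mem_map.1 (mem_coe.1 hb)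
  exact hN.1 haN hbN fun h => hab (congrArg _ h)

theorem dg_eq_degree [DecidableRel G.Adj] (v : V) : dg G v = G.degree v := by
  rw [← G.card_neighborFinset_eq_degree]
  unfold dg
  congr 1
  ext t
  simp [mem_nb]

/-- A graph that is not `d`-colorable and whose Ore-degree is at most `2 * d + 1` contains
`K_{d+1}`. -/
theorem not_cliqueFree [DecidableRel G.Adj] (hd : 5 ≤ d) (hnc : ¬ G.Colorable d)
    (ore : ∀ u v, G.Adj u v → G.degree u + G.degree v ≤ 2 * d + 1) :
    ¬ G.CliqueFree (d + 1) := by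
  obtain ⟨N, hN⟩ := exists_clique (G := G) hd
    (fun ⟨c, hc⟩ => hnc ⟨.mk c fun {a b} hab => hc a (mem_univ _) b (mem_univ _) hab⟩)
    (fun u v huv => by rw [dg_eq_degree, dg_eq_degree]; exact ore u v huv)
  exact hN.not_cliqueFree

end Final

/-! ### Criticality and complete graphs. -/

theorem not_colorable_completeGraph (d : ℕ) :
    ¬ (SimpleGraph.completeGraph (Fin (d + 1))).Colorable d := by
  intro h
  have := h.card_le_of_pairwise_adj id (by simp [Pairwise])
  simp at this

theorem surjective_of_isCritical {V : Type*} {G : SimpleGraph V} {d : ℕ}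
    (hG : G.IsCritical (d + 1)) (f : SimpleGraph.completeGraph (Fin (d + 1)) ↪g G) :
    Function.Surjective f := by
  by_contra hf
  simp only [Function.Surjective, not_forall, not_exists] at hf
  obtain ⟨x, hx⟩ := hf
  have hne : (⊤ : G.Subgraph).induce (Set.range f) ≠ ⊤ := by
    intro h
    have : x ∈ ((⊤ : G.Subgraph).induce (Set.range f)).verts := by rw [h]; trivial
    obtain ⟨i, hi⟩ := this
    exact hx i hi
  have := hG.2.2 _ hne
  apply not_colorable_completeGraph d
  let g : SimpleGraph.completeGraph (Fin (d + 1)) →g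
      ((⊤ : G.Subgraph).induce (Set.range f)).coe :=
    ⟨fun i => ⟨f i, i, rfl⟩, fun {a b} hab => by
      simpa [SimpleGraph.Subgraph.coe_adj] using hab⟩
  exact this.of_hom g

/-- The complete graph on `d + 1` vertices is `(d + 1)`-critical. -/
theorem isCritical_of_iso {V : Type*} [Fintype V] {G : SimpleGraph V} {d : ℕ} (hd : 1 ≤ d)
    (e : G ≃g SimpleGraph.completeGraph (Fin (d + 1))) : G.IsCritical (d + 1) := by
  classical
  have hcard : Fintype.card V = d + 1 := by simpa using Fintype.card_congr e.toEquiv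
  have hadj : ∀ a b : V, a ≠ b → G.Adj a b := fun a b hab => by
    rw [← e.map_adj_iff]
    simpa using hab
  refine ⟨by omega, fun h => not_colorable_completeGraph d (h.of_hom e.symm.toHom), ?_⟩
  intro H hH
  obtain ⟨x, y, hxy, hH⟩ : ∃ x y, x ≠ y ∧ ¬ H.Adj x y := by
    by_contra! hcon
    apply hH
    ext a b
    · have : Nontrivial V := Fintype.one_lt_card_iff_nontrivial.1 (by omega)
      obtain ⟨b, hb⟩ := exists_ne a
      simpa using H.edge_vert (hcon a b hb.symm)
    · exact ⟨fun h => H.adj_sub h, fun h => hcon a b (G.ne_of_adj h)⟩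
  -- The nonadjacent vertices `x` and `y` share a color; every other vertex is its own color.
  let c : H.coe.Coloring {v : V // v ≠ y} :=
    .mk (fun v => if h : (v : V) = y then ⟨x, hxy⟩ else ⟨v, h⟩) fun {a b} hab => by
      have hab' : H.Adj a b := hab
      have hne := H.adj_sub hab' |>.ne
      by_cases ha : (a : V) = y <;> by_cases hb : (b : V) = y
      · exact (hne (ha.trans hb.symm)).elim
      · simp only [ha, hb, dif_pos, dif_neg, not_false_eq_true, ne_eq, Subtype.mk.injEq]
        intro h
        exact hH (by rw [h, ← ha]; exact hab'.symm)
      · simp only [ha, hb, dif_pos, dif_neg, not_false_eq_true, ne_eq, Subtype.mk.injEq]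
        intro h
        exact hH (by rw [← h, ← hb]; exact hab')
      · simpa [ha, hb] using hne
  have := c.colorable
  rwa [Fintype.card_subtype_compl, Fintype.card_subtype_eq, hcard] at this

end OreBrooks

theorem theorem6p1 (d : ℕ) (hd : 5 ≤ d) :
    (∀ {V : Type*} [Fintype V] (G : SimpleGraph V) [DecidableRel G.Adj],
      (G.IsCritical (d + 1) ∧ G.maxDegree ≤ d + 1 ∧ G.IsIndepSet {v | G.degree v = d + 1}) ↔
        Nonempty (G ≃g SimpleGraph.completeGraph (Fin (d + 1)))) ∧
    (∀ {V : Type*} [Fintype V] (G : SimpleGraph V) [DecidableRel G.Adj],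
      G.chromaticNumber = ((d + 1 : ℕ) : ℕ∞) → G.oreDegree ≤ 2 * d + 1 →
        (SimpleGraph.completeGraph (Fin (d + 1))).IsContained G) := by
  refine ⟨fun {V} _ G _ => ⟨?_, ?_⟩, fun {V} _ G _ hchi hore => ?_⟩
  · rintro ⟨hG, hmax, hind⟩
    have h := OreBrooks.not_cliqueFree hd hG.2.1 fun u v huv => by
      have hu := (G.degree_le_maxDegree u).trans hmax
      have hv := (G.degree_le_maxDegree v).trans hmax
      by_contra hcon
      exact hind (show G.degree u = d + 1 by omega) (show G.degree v = d + 1 by omega) huv.ne huv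
    let f := SimpleGraph.topEmbeddingOfNotCliqueFree h
    exact ⟨(RelIso.ofSurjective f (OreBrooks.surjective_of_isCritical hG f)).symm⟩
  · rintro ⟨e⟩
    have hcard : Fintype.card V = d + 1 := by simpa using Fintype.card_congr e.toEquiv
    have hdeg : ∀ v, G.degree v < d + 1 := fun v => hcard ▸ G.degree_lt_card_verts v
    exact ⟨OreBrooks.isCritical_of_iso (by omega) e,
      G.maxDegree_le_of_forall_degree_le _ fun v => (hdeg v).le,
      fun u hu => ((hdeg u).ne hu).elim⟩
  · rw [← SimpleGraph.not_cliqueFree_iff_top_isContained]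
    refine OreBrooks.not_cliqueFree hd (fun h => ?_) fun u v huv => ?_
    · have := h.chromaticNumber_le
      rw [hchi, Nat.cast_le] at this
      omega
    · exact (Finset.le_sup (f := fun p : V × V => G.degree p.1 + G.degree p.2)
        (by simpa using huv : (u, v) ∈ Finset.univ.filter fun p : V × V => G.Adj p.1 p.2)).trans
        hore
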